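/- **Theorem 4 (The Spectral Theorem for locally $AW^*$-algebras).** A *locally $C^*$-algebra* is a topological $*$-algebra over $\mathbb C$ that is topologically $*$-isomorphic to the projective limit $\varprojlim A_\alpha$ of a projective family of $C^*$-algebras over a directed set, with $*$-homomorphisms as connecting maps; its topology is called the projective topology. It is a *locally $AW^*$-algebra* if, moreover, it is a Baer $*$-algebra, i.e. for each nonempty $S\subseteq A$ the right annihilator $R(S)=\{y\in A: sy=0\ \forall s\in S\}$ equals $gA$ for some projection $g=g^*=g^2$. Projections are ordered by $e\le f\iff e=ef$, and suprema and infima of projections are taken in this order. A family of projections $(e_\lambda)_{\lambda\in\mathbb R}$ is *spectral* if $e_\lambda\le e_\mu$ for $\lambda\le\mu$, $\sup_\lambda e_\lambda=\mathbf 1$, $\inf_\lambda e_\lambda=\mathbf 0$, and $e_\lambda=\sup_{\mu<\lambda}e_\mu$ for all $\lambda$. Let $A$ be a locally $AW^*$-algebra. Then $A$ has an identity $\mathbf 1$, and for every self-adjoint $x\in A$ there is a unique spectral family of projections $(e_\lambda)_{\lambda\in\mathbb R}$ in $A$ such that $$x=\int_{-\infty}^{\infty}\lambda\,de_\lambda ,$$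 where the integral is the limit, in the projective topology of $A$, of the sums $\sum_{i=1}^{n}\mu_i(e_{\lambda_i}-e_{\lambda_{i-1}})$ with $\lambda_0<\dots<\lambda_n$ and $\lambda_{i-1}\le\mu_i\le\lambda_i$, as $\max_i(\lambda_i-\lambda_{i-1})\to0$, $\lambda_0\to-\infty$, $\lambda_n\to+\infty$. This family has the following properties. 1. For every $\lambda\in\mathbb R$, $e_\lambda=r\big((\lambda\mathbf 1-x)_+\big)$. Here $a_+$ is the positive part of a self-adjoint $a$, i.e. the unique positive element (element of the form $b^*b$) such that $a_+-a$ is positive and $a_+(a_+-a)=(a_+-a)a_+=\mathbf 0$; and $r(y)=\mathbf 1-g$, where $g$ is the projection with $R(\{y\})=gA$. 2. Every $e_\lambda$ belongs to every maximal commutative $*$-subalgebra $B$ of $A$ that contains $x$. 3. If $\|x\|_\infty:=\sup_p p(x)<\infty$, the supremum being over all continuous $C^*$-seminorms $p$ on $A$, then for every $\varepsilon>0$ $$x=\int_{-\|x\|_\infty}^{\|x\|_\infty+\varepsilon}\lambda\,de_\lambda ,$$ as the limit in the projective topology of the sums above over partitions of $[-\|x\|_\infty,\|x\|_\infty+\varepsilon]$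 as their mesh tends to $0$. -/

import Mathlib

open Filter Topology

universe u

namespace LocallyAW

/-- A projective family of C*-algebras (not assumed unital) over a partially ordered set `Λ`,
with *-homomorphisms `map : A_β → A_α` for `α ≤ β`. -/
structure ProjectiveFamily (Λ : Type u) [PartialOrder Λ] where
  obj : Λ → Type u
  cstar : ∀ α, NonUnitalCStarAlgebra (obj α)
  map : ∀ {α β : Λ}, α ≤ β → (obj β →⋆ₙₐ[ℂ] obj α)
  map_refl : ∀ (α : Λ) (x : obj α), map (le_refl α) x = x
  map_map : ∀ {α β γ : Λ} (h₁ : α ≤ β) (h₂ : β ≤ γ) (x : obj γ),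
    map h₁ (map h₂ x) = map (h₁.trans h₂) x

attribute [instance] ProjectiveFamily.cstar

/-- The projective limit: the *-algebra of compatible families in the direct product.
As a subset of the product it carries the subspace topology of the product topology
(the projective topology). -/
def ProjectiveFamily.limit {Λ : Type u} [PartialOrder Λ] (F : ProjectiveFamily Λ) :
    NonUnitalStarSubalgebra ℂ (∀ α, F.obj α) where
  carrier := {x | ∀ (α β : Λ) (h : α ≤ β), F.map h (x β) = x α}
  add_mem' := by
    intro a b ha hb α β h
    simp only [Pi.add_apply, map_add, ha α β h, hb α β h]
  zero_mem' := by
    intro α β h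
    simp only [Pi.zero_apply, map_zero]
  mul_mem' := by
    intro a b ha hb α β h
    simp only [Pi.mul_apply, map_mul, ha α β h, hb α β h]
  smul_mem' := by
    intro c a ha α β h
    simp only [Pi.smul_apply, map_smul, ha α β h]
  star_mem' := by
    intro a ha α β h
    simp only [Pi.star_apply, map_star, ha α β h]

section

variable (A : Type u) [NonUnitalRing A] [StarRing A] [Module ℂ A]

/-- A locally C*-algebra: a topological *-algebra which is topologically *-isomorphic to the
projective limit of a projective family of C*-algebras over a (nonempty) directed set. -/
def IsLocallyCStarAlgebra [TopologicalSpace A] : Prop :=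
  ∃ (Λ : Type u) (_ : PartialOrder Λ) (_ : IsDirectedOrder Λ) (_ : Nonempty Λ)
    (F : ProjectiveFamily Λ) (φ : A ≃⋆ₐ[ℂ] F.limit), IsHomeomorph φ

end

section

variable {A : Type u} [NonUnitalRing A] [StarRing A]

/-- The right annihilator `R(S) = {x : s x = 0 for all s ∈ S}`. -/
def rightAnnihilator (S : Set A) : Set A := {x | ∀ s ∈ S, s * x = 0}

/-- The set `gA`. -/
def principalRight (g : A) : Set A := Set.range fun a => g * a

/-- The order of projections: `e ≤ f` iff `e = ef`. -/
def ProjLE (e f : A) : Prop := e = e * f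

/-- `p` is the supremum of `S` in the partially ordered set of projections. -/
def IsProjSup (S : Set A) (p : A) : Prop :=
  IsStarProjection p ∧ (∀ e ∈ S, ProjLE e p) ∧
    ∀ q, IsStarProjection q → (∀ e ∈ S, ProjLE e q) → ProjLE p q

/-- `p` is the infimum of `S` in the partially ordered set of projections. -/
def IsProjInf (S : Set A) (p : A) : Prop :=
  IsStarProjection p ∧ (∀ e ∈ S, ProjLE p e) ∧
    ∀ q, IsStarProjection q → (∀ e ∈ S, ProjLE q e) → ProjLE q p

/-- `one` is a two-sided identity. -/
def IsUnitElement (one : A) : Prop := ∀ a : A, one * a = a ∧ a * one = a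

/-- `p` is the right support `1 - g` of `x`, where `g` is the projection with `R({x}) = gA`. -/
def IsRightSupport (one x p : A) : Prop :=
  ∃ g, IsStarProjection g ∧ rightAnnihilator {x} = principalRight g ∧ p = one - g

/-- Positive elements: those of the form `b* b`. -/
def IsPositive (a : A) : Prop := ∃ b : A, a = star b * b

/-- `a` is the positive part of `x`: `x = a - b` with `a, b` positive and `ab = ba = 0`. -/
def IsPositivePart (x a : A) : Prop :=
  ∃ b, IsPositive a ∧ IsPositive b ∧ x = a - b ∧ a * b = 0 ∧ b * a = 0

/-- A spectral family of projections. -/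
structure IsSpectralFamily (one : A) (e : ℝ → A) : Prop where
  isProj : ∀ t, IsStarProjection (e t)
  mono : ∀ s t, s ≤ t → ProjLE (e s) (e t)
  sup_eq_one : IsProjSup (Set.range e) one
  inf_eq_zero : IsProjInf (Set.range e) 0
  left_cont : ∀ t, IsProjSup (e '' Set.Iio t) (e t)

end

/-- A Baer *-algebra: the right annihilator of each nonempty subset is `gA` for a
projection `g`. -/
def IsBaerStar (A : Type u) [NonUnitalRing A] [StarRing A] : Prop :=
  ∀ S : Set A, S.Nonempty →
    ∃ g : A, IsStarProjection g ∧ rightAnnihilator S = principalRight g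

/-- A locally AW*-algebra: a locally C*-algebra which is a Baer *-algebra. -/
structure IsLocallyAWStarAlgebra (A : Type u) [NonUnitalRing A] [StarRing A] [Module ℂ A]
    [TopologicalSpace A] : Prop where
  locallyCStar : IsLocallyCStarAlgebra A
  baer : IsBaerStar A

/-- `p` is a continuous C*-seminorm. -/
structure IsContinuousCStarSeminorm {A : Type u} [NonUnitalRing A] [StarRing A] [Module ℂ A]
    [TopologicalSpace A] (p : Seminorm ℂ A) : Prop where
  mul_le : ∀ a b, p (a * b) ≤ p a * p b
  star_mul_self : ∀ a, p (star a * a) = p a ^ 2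
  cont : Continuous p

/-- `x` is bounded with `‖x‖_∞ = M`, where `‖x‖_∞` is the supremum of `p x` over all
continuous C*-seminorms `p`. -/
def HasSupNorm {A : Type u} [NonUnitalRing A] [StarRing A] [Module ℂ A]
    [TopologicalSpace A] (x : A) (M : ℝ) : Prop :=
  IsLUB {r : ℝ | ∃ p : Seminorm ℂ A, IsContinuousCStarSeminorm p ∧ r = p x} M

/-- A maximal commutative *-subalgebra. -/
def IsMaximalCommutative {A : Type u} [NonUnitalRing A] [StarRing A] [Module ℂ A]
    (B : NonUnitalStarSubalgebra ℂ A) : Prop :=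
  Maximal (fun C : NonUnitalStarSubalgebra ℂ A => ∀ a ∈ C, ∀ b ∈ C, a * b = b * a) B

/-- `l 0 < l 1 < ⋯ < l n` is a partition with tags `m i ∈ [l i, l (i + 1)]` and mesh less
than `δ`. -/
structure IsTaggedPartition (δ : ℝ) (n : ℕ) (l m : ℕ → ℝ) : Prop where
  lt : ∀ i < n, l i < l (i + 1)
  tag_ge : ∀ i < n, l i ≤ m i
  tag_le : ∀ i < n, m i ≤ l (i + 1)
  mesh : ∀ i < n, l (i + 1) - l i < δ

section

variable {A : Type u} [NonUnitalRing A] [Module ℂ A]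

/-- The Riemann–Stieltjes sum of the identity function against `e`. -/
def stieltjesSum (e : ℝ → A) (n : ℕ) (l m : ℕ → ℝ) : A :=
  ∑ i ∈ Finset.range n, (m i : ℂ) • (e (l (i + 1)) - e (l i))

variable [TopologicalSpace A]

/-- `∫_a^b t de_t = y`: the Riemann–Stieltjes sums over `[a, b]` converge to `y` in the
topology of `A` as the mesh tends to `0`. -/
def HasStieltjesIntegral (e : ℝ → A) (a b : ℝ) (y : A) : Prop :=
  ∀ U ∈ 𝓝 y, ∃ δ > 0, ∀ (n : ℕ) (l m : ℕ → ℝ), IsTaggedPartition δ n l m →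
    l 0 = a → l n = b → stieltjesSum e n l m ∈ U

/-- `∫_{-∞}^{∞} t de_t = y`: the Riemann–Stieltjes sums over `[l 0, l n]` converge to `y` in
the topology of `A` as the mesh tends to `0`, `l 0` to `-∞` and `l n` to `∞`. -/
def HasStieltjesIntegralLine (e : ℝ → A) (y : A) : Prop :=
  ∀ U ∈ 𝓝 y, ∃ δ > 0, ∃ R : ℝ, ∀ (n : ℕ) (l m : ℕ → ℝ), IsTaggedPartition δ n l m →
    l 0 ≤ -R → R ≤ l n → stieltjesSum e n l m ∈ U

end

end LocallyAW

namespace LocallyAW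

/-! The algebra is realised as a projective limit of C*-algebras. Continuous functional calculus
commutes with *-homomorphisms, so `t 1 - x` has a positive part `a`, computed componentwise. The
components need not be Baer; only the limit supplies the projection `g` with `R({a}) = gA`, and `e t
= 1 - g`. Since the negative part lies in `R({a})`, one gets `(t 1 - x) e t = a`, and `e t` commutes
with everything that commutes with `x`.

In each component `e t` is then a cut (`IsCut`): it commutes with `x`, with `x ≤ t` under it and `x
≥ t` off it. Order arguments alone give that cuts at `s < t` are comparable (`IsCut.projLE_of_lt`),
that cuts are trivial beyond `±‖x‖`, and that Riemann–Stieltjes sums of mesh `δ` lie within `3 δ` of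
`x` (`norm_stieltjesSum_sub_le`). A cut is not unique at an eigenvalue, so left continuity needs the
support property in `A` itself (`IsSpectralProjection.isProjSup_Iio`).

For uniqueness, convergence forces a competing family `f` to be constant near `±∞` in each
component; these constants glue to projections of `A`, which must be `0` and `1`. Passing to the
limit in Riemann sums, each component of `f` is a family of cuts. Thus `f s ≤ e t` and `e s ≤ f t`
for `s < t`, and left continuity of both families gives `f = e`. -/

theorem ProjLE.mul_eq {R : Type*} [NonUnitalRing R] {p q : R} (h : ProjLE p q) : p * q = p :=
  Eq.symm h

/-! ### Order of projections. -/

section Ring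

variable {R : Type*} [NonUnitalRing R] [StarRing R] {p q : R}

theorem mul_eq_of_mul_eq_left (hp : IsSelfAdjoint p) (hq : IsSelfAdjoint q) (h : q * p = p) :
    p * q = p := by
  simpa [hp.star_eq, hq.star_eq] using congrArg star h

namespace ProjLE

theorem mul_eq_left (h : ProjLE p q) (hp : IsStarProjection p) (hq : IsStarProjection q) :
    q * p = p := by
  simpa [hp.isSelfAdjoint.star_eq, hq.isSelfAdjoint.star_eq] using congrArg star h.mul_eq

theorem isStarProjection_sub (h : ProjLE p q) (hp : IsStarProjection p)
    (hq : IsStarProjection q) : IsStarProjection (q - p) := by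
  refine ⟨?_, hq.isSelfAdjoint.sub hp.isSelfAdjoint⟩
  simp [IsIdempotentElem, sub_mul, mul_sub, h.mul_eq, h.mul_eq_left hp hq,
    hp.isIdempotentElem.eq, hq.isIdempotentElem.eq]

theorem antisymm (h : ProjLE p q) (h' : ProjLE q p) (hp : IsStarProjection p)
    (hq : IsStarProjection q) : p = q :=
  h.trans (h'.mul_eq_left hq hp)

end ProjLE

end Ring

theorem eq_zero_of_norm_lt_one {C : Type*} [NonUnitalCStarAlgebra C] {d : C}
    (hd : IsStarProjection d) (h : ‖d‖ < 1) : d = 0 := by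
  have h1 : ‖d‖ = ‖d‖ * ‖d‖ := by
    rw [← CStarRing.norm_star_mul_self, hd.isSelfAdjoint.star_eq, hd.isIdempotentElem.eq]
  by_contra hne
  have : 0 < ‖d‖ := norm_pos_iff.2 hne
  nlinarith

/-! ### Cuts in a single C*-algebra and the Riemann sum estimate. -/

section CStar

variable {C : Type*} [NonUnitalCStarAlgebra C] [PartialOrder C]

/-- The projection `p` separates the part of `x` below `t` from the part above `t`,
inside the corner with unit `u`. -/
structure IsCut (u x : C) (t : ℝ) (p : C) : Prop where
  isProj : IsStarProjection p
  unit_mul : u * p = p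
  comm : Commute p x
  nonneg_below : 0 ≤ t • p - x * p
  nonneg_above : 0 ≤ x * (u - p) - t • (u - p)

theorem IsCut.projLE_unit {u x p : C} {t : ℝ} (hu : IsStarProjection u)
    (hp : IsCut u x t p) : ProjLE p u :=
  (mul_eq_of_mul_eq_left hp.isProj.isSelfAdjoint hu.isSelfAdjoint hp.unit_mul).symm

variable [StarOrderedRing C]

/-- Conjugation by `d` preserves positivity, and absorbs `p` because `d` lies under `p`. -/
theorem sub_mul_nonneg_compress {x p d : C} {t : ℝ} (hd : IsStarProjection d)
    (hdx : Commute d x) (hpd : p * d = d) (h : 0 ≤ t • p - x * p) : 0 ≤ t • d - x * d := by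
  have h1 := star_left_conjugate_nonneg h d
  have h2 : star d * (t • p - x * p) * d = t • d - x * d := by
    rw [hd.isSelfAdjoint.star_eq, mul_sub, sub_mul, mul_assoc, mul_assoc, smul_mul_assoc, hpd,
      mul_assoc x, hpd, mul_smul_comm, ← mul_assoc, hdx.eq, mul_assoc, hd.isIdempotentElem.eq]
  rwa [h2] at h1

theorem mul_sub_nonneg_compress {x p d : C} {t : ℝ} (hd : IsStarProjection d)
    (hdx : Commute d x) (hpd : p * d = d) (h : 0 ≤ x * p - t • p) : 0 ≤ x * d - t • d := by
  have := sub_mul_nonneg_compress (x := -x) (t := -t) hd hdx.neg_right hpd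
    (by simpa [neg_add_eq_sub] using h)
  simpa [neg_add_eq_sub] using this

theorem eq_zero_of_norm_lt {x d : C} {t : ℝ} (hd : IsStarProjection d)
    (h : 0 ≤ x * d - t • d) (ht : ‖x‖ < t) : d = 0 := by
  have h0 : 0 ≤ t := (norm_nonneg x).trans ht.le
  have h1 := CStarAlgebra.norm_le_norm_of_nonneg_of_le (smul_nonneg h0 hd.nonneg)
    (sub_nonneg.1 h)
  rw [norm_smul, Real.norm_of_nonneg h0] at h1
  have h2 := h1.trans (norm_mul_le x d)
  by_contra hne
  have : 0 < ‖d‖ := norm_pos_iff.2 hne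
  nlinarith

theorem eq_zero_of_lt_neg_norm {x d : C} {t : ℝ} (hd : IsStarProjection d)
    (h : 0 ≤ t • d - x * d) (ht : t < -‖x‖) : d = 0 :=
  eq_zero_of_norm_lt (x := -x) (t := -t) hd (by simpa [neg_add_eq_sub] using h)
    (by rw [norm_neg]; linarith)

/-- An element between `-r u` and `r u` for a projection `u` has norm at most `3 r`. -/
theorem norm_le_of_mem_interval {u y : C} {r : ℝ} (hr : 0 ≤ r) (hu : IsStarProjection u)
    (h1 : 0 ≤ r • u - y) (h2 : 0 ≤ y + r • u) : ‖y‖ ≤ 3 * r := by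
  have h3 : y + r • u ≤ (2 * r) • u := by
    rw [← sub_nonneg]; convert h1 using 1; module
  have h4 := CStarAlgebra.norm_le_norm_of_nonneg_of_le h2 h3
  have h5 : ‖u‖ ≤ 1 := hu.norm_le
  have h6 : ‖(2 * r) • u‖ ≤ 2 * r := by
    rw [norm_smul, Real.norm_of_nonneg (by positivity)]; nlinarith
  have h7 : ‖r • u‖ ≤ r := by
    rw [norm_smul, Real.norm_of_nonneg hr]; nlinarith
  calc ‖y‖ = ‖(y + r • u) - r • u‖ := by rw [add_sub_cancel_right]
    _ ≤ ‖y + r • u‖ + ‖r • u‖ := norm_sub_le _ _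
    _ ≤ 3 * r := by linarith

namespace IsCut

variable {u x p q : C} {s t : ℝ}

/-- The projection `d = p - p q` lies under both `p` and `u - q`, so `t d ≤ x d ≤ s d`, which forces
`d = 0`. Strictness of `s < t` is essential: two cuts at the same `t` may divide the `t`-eigenspace
differently. -/
theorem projLE_of_lt (hp : IsCut u x s p) (hq : IsCut u x t q)
    (hst : s < t) (hpq : Commute p q) : ProjLE p q := by
  have hp2 := hp.isProj.isIdempotentElem.eq
  have hq2 := hq.isProj.isIdempotentElem.eq
  set d := p - p * q with hd
  have hpqp : p * q * p = p * q := by rw [mul_assoc, ← hpq.eq, ← mul_assoc, hp2]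
  have hdp : IsStarProjection d := by
    refine ⟨?_, ?_⟩
    · simp only [IsIdempotentElem, hd, sub_mul, mul_sub, hp2, ← mul_assoc, hpqp]
      rw [mul_assoc p q q, hq2]; abel
    · simp [hd, IsSelfAdjoint, hp.isProj.isSelfAdjoint.star_eq, hq.isProj.isSelfAdjoint.star_eq,
        hpq.eq]
  have hdx : Commute d x := hp.comm.sub_left (hp.comm.mul_left hq.comm)
  have h1 := sub_mul_nonneg_compress hdp hdx (p := p)
    (by simp [hd, mul_sub, ← mul_assoc, hp2]) hp.nonneg_below
  have h2 := mul_sub_nonneg_compress hdp hdx (p := u - q)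
    (by
      simp only [hd, mul_sub, sub_mul, ← mul_assoc, hp.unit_mul, ← hpq.eq]
      rw [mul_assoc p q q, hq2]; abel) hq.nonneg_above
  have h3 : 0 ≤ -((t - s) • d) := by
    have := add_nonneg h1 h2
    convert this using 1
    module
  have h4 : (t - s) • d = 0 :=
    le_antisymm (neg_nonneg.1 h3) (smul_nonneg (sub_nonneg.2 hst.le) hdp.nonneg)
  have h5 : d = 0 := (smul_eq_zero.1 h4).resolve_left (sub_pos.2 hst).ne'
  exact sub_eq_zero.1 h5

theorem eq_unit_of_norm_lt (hu : IsStarProjection u) (hp : IsCut u x t p) (ht : ‖x‖ < t) :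
    p = u :=
  (sub_eq_zero.1 (eq_zero_of_norm_lt
    ((hp.projLE_unit hu).isStarProjection_sub hp.isProj hu) hp.nonneg_above ht)).symm

theorem eq_zero_of_lt (hp : IsCut u x t p) (ht : t < -‖x‖) : p = 0 :=
  eq_zero_of_lt_neg_norm hp.isProj hp.nonneg_below ht

theorem band_nonneg (hp : IsCut u x s p) (hq : IsCut u x t q) (hpq : ProjLE p q) :
    0 ≤ t • (q - p) - x * (q - p) ∧ 0 ≤ x * (q - p) - s • (q - p) := by
  have hpq' := hpq.mul_eq_left hp.isProj hq.isProj
  have hd := hpq.isStarProjection_sub hp.isProj hq.isProj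
  have hdx : Commute (q - p) x := hq.comm.sub_left hp.comm
  refine ⟨sub_mul_nonneg_compress hd hdx (p := q) ?_ hq.nonneg_below,
    mul_sub_nonneg_compress hd hdx (p := u - p) ?_ hp.nonneg_above⟩
  · rw [mul_sub, hq.isProj.isIdempotentElem.eq, hpq']
  · rw [sub_mul, mul_sub, mul_sub, hq.unit_mul, hp.unit_mul, hpq.mul_eq,
      hp.isProj.isIdempotentElem.eq, sub_self, sub_zero]

/-- The part of `x` just below `t` is small. -/
theorem norm_band_mul_le (hp : IsCut u x s p) (hq : IsCut u x t q) (hst : s ≤ t)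
    (hpq : ProjLE p q) {r : C} (hr : p * r = 0) :
    ‖(t • q - x * q) * r‖ ≤ (t - s) * ‖r‖ := by
  obtain ⟨h1, h2⟩ := hp.band_nonneg hq hpq
  have hd := hpq.isStarProjection_sub hp.isProj hq.isProj
  have h3 : t • (q - p) - x * (q - p) ≤ (t - s) • (q - p) := by
    rw [← sub_nonneg]; convert h2 using 1; module
  have h4 := CStarAlgebra.norm_le_norm_of_nonneg_of_le h1 h3
  have h5 : ‖(t - s) • (q - p)‖ ≤ t - s := by
    rw [norm_smul, Real.norm_of_nonneg (sub_nonneg.2 hst)]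
    have := hd.norm_le
    nlinarith
  -- Since `p` kills `r`, only the band `q - p` acts on `r`.
  have h6 : (t • q - x * q) * r = (t • (q - p) - x * (q - p)) * r := by
    simp only [sub_mul, mul_sub, smul_sub, smul_mul_assoc, mul_assoc, hr]
    simp
  rw [h6]
  exact (norm_mul_le _ _).trans (mul_le_mul_of_nonneg_right (h4.trans h5) (norm_nonneg _))

end IsCut

/-- The increments of `f` telescope to `u`, and on each of them the tag differs from `x` by at most
`δ` in the order sense. Summing these inequalities places the error between `-δ u` and `δ u`. -/
theorem norm_stieltjesSum_sub_le {u x : C} (hu : IsStarProjection u) (hxu : x * u = x)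
    {f : ℝ → C} (hf : ∀ t, IsCut u x t (f t)) (hmono : ∀ s t, s ≤ t → ProjLE (f s) (f t))
    {δ : ℝ} (hδ : 0 ≤ δ) {n : ℕ} {l m : ℕ → ℝ} (hP : IsTaggedPartition δ n l m)
    (h0 : f (l 0) = 0) (hn : f (l n) = u) : ‖stieltjesSum f n l m - x‖ ≤ 3 * δ := by
  have hsum : ∑ i ∈ Finset.range n, (f (l (i + 1)) - f (l i)) = u := by
    rw [Finset.sum_range_sub (fun i => f (l i)), h0, hn, sub_zero]
  have hx : stieltjesSum f n l m - x = ∑ i ∈ Finset.range n,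
      ((m i : ℂ) • (f (l (i + 1)) - f (l i)) - x * (f (l (i + 1)) - f (l i))) := by
    rw [Finset.sum_sub_distrib, ← Finset.mul_sum, hsum, hxu, stieltjesSum]
  have hdu : δ • u = ∑ i ∈ Finset.range n, δ • (f (l (i + 1)) - f (l i)) := by
    rw [← Finset.smul_sum, hsum]
  have key : ∀ i ∈ Finset.range n,
      0 ≤ (f (l (i + 1)) - f (l i)) ∧
      0 ≤ l (i + 1) • (f (l (i + 1)) - f (l i)) - x * (f (l (i + 1)) - f (l i)) ∧
      0 ≤ x * (f (l (i + 1)) - f (l i)) - l i • (f (l (i + 1)) - f (l i)) := by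
    intro i hi
    have hm := hmono _ _ (hP.lt i (Finset.mem_range.1 hi)).le
    exact ⟨(hm.isStarProjection_sub (hf _).isProj (hf _).isProj).nonneg,
      (hf _).band_nonneg (hf _) hm⟩
  refine norm_le_of_mem_interval hδ hu ?_ ?_
  · rw [hdu, hx, ← Finset.sum_sub_distrib]
    refine Finset.sum_nonneg fun i hi => ?_
    obtain ⟨k0, -, k2⟩ := key i hi
    have hi' := Finset.mem_range.1 hi
    have k3 := smul_nonneg (show 0 ≤ δ - (m i - l i) by
      linarith [hP.mesh i hi', hP.tag_le i hi']) k0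
    rw [Complex.coe_smul]
    convert add_nonneg k2 k3 using 1
    module
  · rw [hdu, hx, ← Finset.sum_add_distrib]
    refine Finset.sum_nonneg fun i hi => ?_
    obtain ⟨k0, k1, -⟩ := key i hi
    have hi' := Finset.mem_range.1 hi
    have k3 := smul_nonneg (show 0 ≤ δ - (l (i + 1) - m i) by
      linarith [hP.mesh i hi', hP.tag_ge i hi']) k0
    rw [Complex.coe_smul]
    convert add_nonneg k1 k3 using 1
    module

end CStar

/-- The uniform partition with step `h` starting at `a`. -/
def uniformPartition (a h : ℝ) (i : ℕ) : ℝ := a + i * h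

@[simp] theorem uniformPartition_zero (a h : ℝ) : uniformPartition a h 0 = a := by
  simp [uniformPartition]

theorem uniformPartition_succ (a h : ℝ) (i : ℕ) :
    uniformPartition a h (i + 1) = uniformPartition a h i + h := by
  simp [uniformPartition]; ring

theorem uniformPartition_sub_succ (a h : ℝ) (i : ℕ) :
    uniformPartition (a - h) h (i + 1) = uniformPartition a h i := by
  simp [uniformPartition]; ring

theorem isTaggedPartition_uniformPartition {δ h : ℝ} (hh : 0 < h) (hδ : h < δ) (a : ℝ) (n : ℕ)
    {m : ℕ → ℝ} (hm : ∀ i, uniformPartition a h i ≤ m i)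
    (hm' : ∀ i, m i ≤ uniformPartition a h (i + 1)) :
    IsTaggedPartition δ n (uniformPartition a h) m where
  lt i _ := by rw [uniformPartition_succ]; linarith
  tag_ge i _ := hm i
  tag_le i _ := hm' i
  mesh i _ := by rw [uniformPartition_succ]; linarith

/-! ### Monotone families with a convergent integral in a single C*-algebra. -/

section CStar

variable {C : Type*} [NonUnitalCStarAlgebra C]

theorem HasStieltjesIntegralLine.exists_uniform {f : ℝ → C} {x : C}
    (hx : HasStieltjesIntegralLine f x) {ε : ℝ} (hε : 0 < ε) :
    ∃ h > 0, ∃ R : ℝ, ∀ (a : ℝ) (n : ℕ) (m : ℕ → ℝ), a ≤ -R → R ≤ a + n * h →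
      (∀ i, uniformPartition a h i ≤ m i) → (∀ i, m i ≤ uniformPartition a h (i + 1)) →
      ‖stieltjesSum f n (uniformPartition a h) m - x‖ < ε := by
  obtain ⟨δ, hδ, R, H⟩ := hx (Metric.ball x ε) (Metric.ball_mem_nhds x hε)
  refine ⟨δ / 2, by positivity, R, fun a n m ha hn hm hm' => ?_⟩
  rw [← mem_ball_iff_norm]
  exact H n _ m (isTaggedPartition_uniformPartition (by positivity) (by linarith) a n hm hm')
    (by simpa using ha) hn

/-- A closed set that contains all Riemann–Stieltjes sums over sufficiently long uniform
partitions, tagged by a prescribed rule, contains the integral. -/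
theorem HasStieltjesIntegralLine.mem_of_isClosed {f : ℝ → C} {x : C}
    (hx : HasStieltjesIntegralLine f x) {K : Set C} (hK : IsClosed K) (R : ℝ)
    (tag : (ℕ → ℝ) → ℕ → ℝ) (htag : ∀ l i, l i ≤ l (i + 1) → l i ≤ tag l i)
    (htag' : ∀ l i, l i ≤ l (i + 1) → tag l i ≤ l (i + 1))
    (H : ∀ (n : ℕ) (l : ℕ → ℝ), (∀ i, l i ≤ l (i + 1)) → l 0 ≤ -R → R ≤ l n →
      stieltjesSum f n l (tag l) ∈ K) : x ∈ K := by
  rw [← hK.closure_eq, Metric.mem_closure_iff]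
  intro ε hε
  obtain ⟨h, hh, R', H'⟩ := hx.exists_uniform hε
  set a := -max R R'
  obtain ⟨n, hn⟩ := exists_nat_ge ((max R R' - a) / h)
  have hn' : max R R' ≤ a + n * h := by
    rw [div_le_iff₀ hh] at hn; linarith
  have hl : ∀ i, uniformPartition a h i ≤ uniformPartition a h (i + 1) := fun i => by
    rw [uniformPartition_succ]; linarith
  refine ⟨_, H n (uniformPartition a h) hl ?_ ?_, ?_⟩
  · rw [uniformPartition_zero]; exact neg_le_neg (le_max_left _ _)
  · exact (le_max_left _ _).trans hn'
  · rw [dist_comm, dist_eq_norm]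
    exact H' a n _ (neg_le_neg (le_max_right _ _)) ((le_max_right _ _).trans hn')
      (fun i => htag _ _ (hl i)) (fun i => htag' _ _ (hl i))

theorem eq_of_norm_smul_sub_lt_one {f : ℝ → C} (hproj : ∀ t, IsStarProjection (f t))
    (hmono : ∀ s t, s ≤ t → ProjLE (f s) (f t)) {s t c : ℝ} (hst : s ≤ t) (hc : 1 ≤ |c|)
    (h : ‖(c : ℂ) • (f t - f s)‖ < 1) : f s = f t := by
  have hd := (hmono s t hst).isStarProjection_sub (hproj s) (hproj t)
  refine (sub_eq_zero.1 (eq_zero_of_norm_lt_one hd ?_)).symm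
  rw [norm_smul, Complex.norm_real, Real.norm_eq_abs] at h
  nlinarith [norm_nonneg (f t - f s)]

theorem eq_of_sandwich {f : ℝ → C} (hproj : ∀ t, IsStarProjection (f t))
    (hmono : ∀ s t, s ≤ t → ProjLE (f s) (f t)) {r s t : ℝ} (hrs : r ≤ s) (hst : s ≤ t)
    (h : f r = f t) : f s = f t :=
  (hmono s t hst).antisymm (h ▸ hmono r s hrs) (hproj s) (hproj t)

/-- Convergence of the improper integral forces the family to be constant near `±∞`. -/
theorem HasStieltjesIntegralLine.eventually_const {f : ℝ → C} {x : C}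
    (hx : HasStieltjesIntegralLine f x) (hproj : ∀ t, IsStarProjection (f t))
    (hmono : ∀ s t, s ≤ t → ProjLE (f s) (f t)) :
    ∃ R : ℝ, (∀ s ≤ -R, f s = f (-R)) ∧ ∀ s, R ≤ s → f s = f R := by
  -- Two sums within `1 / 2` of `x` differ by less than `1`, while a nonzero projection has norm at
  -- least `1`. The bound `1 ≤ R` keeps the tag of an added outer cell at absolute value at least
  -- `1`.
  obtain ⟨h, hh, R₀, H⟩ := hx.exists_uniform (ε := 1 / 2) (by norm_num)
  set R := max R₀ 1
  have hR₀ : R₀ ≤ R := le_max_left _ _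
  have hR : 1 ≤ R := le_max_right _ _
  have hS : ∀ (a : ℝ) (n : ℕ), a ≤ -R → R ≤ a + n * h →
      ‖stieltjesSum f n (uniformPartition a h) (uniformPartition a h) - x‖ < 1 / 2 :=
    fun a n ha hn => H a n _ (by linarith) (by linarith) (fun _ => le_rfl) fun i => by
      rw [uniformPartition_succ]; linarith
  have hdist : ∀ {y z : C}, ‖y - x‖ < 1 / 2 → ‖z - x‖ < 1 / 2 → ‖y - z‖ < 1 := by
    intro y z hy hz
    have := norm_sub_le (y - x) (z - x)
    rw [sub_sub_sub_cancel_right] at this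
    linarith
  -- Prepending the cell `[a - h, a]`, tagged on the left, changes the sum by exactly `(a - h) (f a
  -- - f (a - h))`.
  have low : ∀ a ≤ -R, f (a - h) = f a := by
    intro a ha
    obtain ⟨n, hn⟩ := exists_nat_ge ((R - a) / h)
    rw [div_le_iff₀ hh] at hn
    have h1 := hS a n ha (by linarith)
    have h2 := hS (a - h) (n + 1) (by linarith) (by push_cast; linarith)
    have h3 := hdist h2 h1
    rw [stieltjesSum, Finset.sum_range_succ'] at h3
    simp only [uniformPartition_sub_succ, uniformPartition_zero] at h3
    rw [stieltjesSum, add_sub_cancel_left] at h3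
    refine eq_of_norm_smul_sub_lt_one hproj hmono (by linarith) ?_ h3
    rw [abs_of_nonpos (by linarith)]; linarith
  have high : ∀ b, R ≤ b → f b = f (b + h) := by
    intro b hb
    obtain ⟨n, hn⟩ := exists_nat_ge ((b + R) / h)
    rw [div_le_iff₀ hh] at hn
    have h1 := hS (b - n * h) n (by linarith) (by linarith)
    have h2 := hS (b - n * h) (n + 1) (by linarith) (by push_cast; linarith)
    have h3 := hdist h2 h1
    have hb' : uniformPartition (b - n * h) h n = b := by simp [uniformPartition]
    rw [stieltjesSum, Finset.sum_range_succ, ← stieltjesSum, add_sub_cancel_left,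
      uniformPartition_succ, hb'] at h3
    refine eq_of_norm_smul_sub_lt_one hproj hmono (by linarith) ?_ h3
    rw [abs_of_nonneg (by linarith)]; linarith
  have low' : ∀ k : ℕ, f (-R - k * h) = f (-R) := by
    intro k
    induction k with
    | zero => simp
    | succ k ih =>
      rw [← ih, ← low (-R - k * h) (by have : 0 ≤ k * h := by positivity
                                       linarith)]
      congr 1; push_cast; ring
  have high' : ∀ k : ℕ, f R = f (R + k * h) := by
    intro k
    induction k with
    | zero => simp
    | succ k ih =>
      rw [ih, high (R + k * h) (by have : 0 ≤ k * h := by positivity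
                                   linarith)]
      congr 1; push_cast; ring
  refine ⟨R, fun s hs => ?_, fun s hs => ?_⟩
  · obtain ⟨k, hk⟩ := exists_nat_ge ((-R - s) / h)
    rw [div_le_iff₀ hh] at hk
    exact eq_of_sandwich hproj hmono (r := -R - k * h) (by linarith) hs (low' k)
  · obtain ⟨k, hk⟩ := exists_nat_ge ((s - R) / h)
    rw [div_le_iff₀ hh] at hk
    rw [high' k]
    exact eq_of_sandwich hproj hmono (t := R + k * h) hs (by linarith) (high' k)

theorem commute_of_mono {f : ℝ → C} (hproj : ∀ t, IsStarProjection (f t))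
    (hmono : ∀ s t, s ≤ t → ProjLE (f s) (f t)) (s t : ℝ) : Commute (f s) (f t) := by
  rcases le_total s t with h | h
  · exact (hmono s t h).mul_eq.trans ((hmono s t h).mul_eq_left (hproj s) (hproj t)).symm
  · exact ((hmono t s h).mul_eq_left (hproj t) (hproj s)).trans (hmono t s h).mul_eq.symm

variable [PartialOrder C] [StarOrderedRing C]

theorem nonneg_mul_of_commute {d p : C} (hd : IsStarProjection d) (hp : IsStarProjection p)
    (h : Commute d p) : 0 ≤ d * p := by
  have := star_left_conjugate_nonneg hd.nonneg p
  rwa [hp.isSelfAdjoint.star_eq, ← h.eq, mul_assoc, hp.isIdempotentElem.eq] at this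

/-- Each condition on `x` is closed, so it is enough to check it on Riemann sums. Left tags suit the
part below `t` and right tags the part above: a cell straddling `t` then has a coefficient of the
right sign, and cells with the wrong sign are annihilated. -/
theorem HasStieltjesIntegralLine.isCut {u x : C} {f : ℝ → C}
    (hx : HasStieltjesIntegralLine f x) (hproj : ∀ t, IsStarProjection (f t))
    (hmono : ∀ s t, s ≤ t → ProjLE (f s) (f t)) (hu : IsStarProjection u)
    (huf : ∀ t, u * f t = f t) {R : ℝ} (hlow : ∀ s ≤ -R, f s = 0) (hhigh : ∀ s, R ≤ s → f s = u)
    (t : ℝ) : IsCut u x t (f t) := by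
  have hsum : ∀ (n : ℕ) (l : ℕ → ℝ), l 0 ≤ -R → R ≤ l n →
      ∑ i ∈ Finset.range n, (f (l (i + 1)) - f (l i)) = u := by
    intro n l h0 hn
    rw [Finset.sum_range_sub (fun i => f (l i)), hlow _ h0, hhigh _ hn, sub_zero]
  have hcomm := commute_of_mono hproj hmono
  have hfu : f t * u = f t :=
    mul_eq_of_mul_eq_left (hproj t).isSelfAdjoint hu.isSelfAdjoint (huf t)
  have hut : IsStarProjection (u - f t) :=
    ProjLE.isStarProjection_sub hfu.symm (hproj t) hu
  have hsplit : ∀ {r s : ℝ}, r ≤ s → IsStarProjection (f s - f r) :=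
    fun h => (hmono _ _ h).isStarProjection_sub (hproj _) (hproj _)
  refine ⟨hproj t, huf t, ?_, ?_, ?_⟩
  · refine hx.mem_of_isClosed (K := {y | Commute (f t) y}) ?_ R (fun l => l)
      (fun _ _ _ => le_rfl) (fun _ _ h => h) fun n l _ _ _ => ?_
    · exact isClosed_eq (continuous_const.mul continuous_id) (continuous_id.mul continuous_const)
    · exact Commute.sum_right _ _ _ fun i _ =>
        ((hcomm t _).sub_right (hcomm t _)).smul_right _
  · refine hx.mem_of_isClosed (K := {y | 0 ≤ t • f t - y * f t}) ?_ R (fun l => l)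
      (fun _ _ _ => le_rfl) (fun _ _ h => h) fun n l hl h0 hn => ?_
    · exact isClosed_le continuous_const
        (continuous_const.sub (continuous_id.mul continuous_const))
    · have h1 : t • f t - stieltjesSum f n l l * f t =
          ∑ i ∈ Finset.range n, (t - l i) • ((f (l (i + 1)) - f (l i)) * f t) := by
        simp only [sub_smul]
        rw [Finset.sum_sub_distrib, ← Finset.smul_sum, ← Finset.sum_mul, hsum n l h0 hn,
          huf, stieltjesSum, Finset.sum_mul]
        simp only [Complex.coe_smul, smul_mul_assoc]
      rw [Set.mem_ofPred_eq, h1]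
      refine Finset.sum_nonneg fun i _ => ?_
      rcases le_total (l i) t with h | h
      · exact smul_nonneg (sub_nonneg.2 h) (nonneg_mul_of_commute (hsplit (hl i)) (hproj t)
          ((hcomm _ t).sub_left (hcomm _ t)))
      · rw [sub_mul, (hmono _ _ h).mul_eq_left (hproj _) (hproj _),
          (hmono _ _ (h.trans (hl i))).mul_eq_left (hproj _) (hproj _), sub_self, smul_zero]
  · refine hx.mem_of_isClosed (K := {y | 0 ≤ y * (u - f t) - t • (u - f t)}) ?_ R
      (fun l i => l (i + 1)) (fun _ _ h => h) (fun _ _ _ => le_rfl) fun n l hl h0 hn => ?_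
    · exact isClosed_le continuous_const
        ((continuous_id.mul continuous_const).sub continuous_const)
    · have h1 : stieltjesSum f n l (fun i => l (i + 1)) * (u - f t) - t • (u - f t) =
          ∑ i ∈ Finset.range n, (l (i + 1) - t) • ((f (l (i + 1)) - f (l i)) * (u - f t)) := by
        simp only [sub_smul]
        rw [Finset.sum_sub_distrib, ← Finset.smul_sum, ← Finset.sum_mul, hsum n l h0 hn,
          mul_sub u, huf, hu.isIdempotentElem.eq, stieltjesSum]
        simp only [Complex.coe_smul, smul_mul_assoc, Finset.sum_mul]
      rw [Set.mem_ofPred_eq, h1]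
      refine Finset.sum_nonneg fun i _ => ?_
      have hsu : ∀ s, f s * u = f s := fun s =>
        mul_eq_of_mul_eq_left (hproj s).isSelfAdjoint hu.isSelfAdjoint (huf s)
      have hcu : ∀ s, Commute (f s) u := fun s => (hsu s).trans (huf s).symm
      rcases le_total t (l (i + 1)) with h | h
      · exact smul_nonneg (sub_nonneg.2 h) (nonneg_mul_of_commute (hsplit (hl i)) hut
          (((hcu _).sub_left (hcu _)).sub_right ((hcomm _ t).sub_left (hcomm _ t))))
      · rw [sub_mul, mul_sub, mul_sub, hsu, hsu, (hmono _ _ h).mul_eq,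
          (hmono _ _ ((hl i).trans h)).mul_eq, sub_self, sub_self, sub_self, smul_zero]

end CStar

/-! ### Passing between the limit and its components. -/

section Coordinates

noncomputable instance {Λ : Type u} [PartialOrder Λ] (F : ProjectiveFamily Λ) (α : Λ) :
    PartialOrder (F.obj α) := CStarAlgebra.spectralOrder _

instance {Λ : Type u} [PartialOrder Λ] (F : ProjectiveFamily Λ) (α : Λ) :
    StarOrderedRing (F.obj α) := CStarAlgebra.spectralOrderedRing _

variable {A : Type u} [NonUnitalRing A] [StarRing A] [Module ℂ A]
variable {Λ : Type u} [PartialOrder Λ] {F : ProjectiveFamily Λ}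

/-- The canonical map of a projective limit to one of its components. -/
def coord (φ : A ≃⋆ₐ[ℂ] F.limit) (α : Λ) : A →⋆ₙₐ[ℂ] F.obj α where
  toFun a := (φ a : ∀ α, F.obj α) α
  map_smul' c a := by simp
  map_zero' := by simp
  map_add' a b := by simp
  map_mul' a b := by simp
  map_star' a := by rw [map_star]; rfl

variable (φ : A ≃⋆ₐ[ℂ] F.limit)

theorem map_coord {α β : Λ} (h : α ≤ β) (a : A) : F.map h (coord φ β a) = coord φ α a :=
  (φ a).2 α β h

theorem ext_coord {a b : A} (h : ∀ α, coord φ α a = coord φ α b) : a = b :=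
  φ.injective (Subtype.ext (funext h))

theorem exists_coord_eq {z : ∀ α, F.obj α}
    (hz : ∀ (α β : Λ) (h : α ≤ β), F.map h (z β) = z α) : ∃ a : A, ∀ α, coord φ α a = z α := by
  refine ⟨φ.symm ⟨z, hz⟩, fun α => ?_⟩
  change (φ (φ.symm ⟨z, hz⟩) : ∀ α, F.obj α) α = z α
  rw [StarAlgEquiv.apply_symm_apply]

theorem coord_real_smul (α : Λ) (r : ℝ) (a : A) :
    coord φ α ((r : ℂ) • a) = r • coord φ α a := by
  rw [map_smul, Complex.coe_smul]

theorem isStarProjection_of_coord {p : A} (hp : ∀ α, IsStarProjection (coord φ α p)) :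
    IsStarProjection p where
  isIdempotentElem := ext_coord φ fun α => by
    rw [map_mul]; exact (hp α).isIdempotentElem
  isSelfAdjoint := ext_coord φ fun α => by
    rw [map_star]; exact (hp α).isSelfAdjoint

theorem projLE_of_coord {p q : A} (h : ∀ α, ProjLE (coord φ α p) (coord φ α q)) : ProjLE p q :=
  ext_coord φ fun α => by rw [map_mul]; exact h α

theorem projLE_coord {p q : A} (h : ProjLE p q) (α : Λ) :
    ProjLE (coord φ α p) (coord φ α q) := by
  rw [ProjLE, ← map_mul, h.mul_eq]

theorem coord_nonneg {a : A} (ha : IsPositive a) (α : Λ) : 0 ≤ coord φ α a := by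
  obtain ⟨b, rfl⟩ := ha
  rw [map_mul, map_star]
  exact star_mul_self_nonneg _

/-- Functional calculus commutes with the connecting maps, so its componentwise values form a
compatible family. The condition `f 0 = 0` is needed because the components may lack a unit. -/
theorem exists_coord_cfcₙ {f : ℝ → ℝ} (hf : Continuous f) (hf0 : f 0 = 0) {y : A}
    (hy : IsSelfAdjoint y) : ∃ a : A, ∀ α, coord φ α a = cfcₙ f (coord φ α y) := by
  refine exists_coord_eq φ fun α β h => ?_
  rw [← map_coord φ h y]
  exact NonUnitalStarAlgHomClass.map_cfcₙ (F.map h) f (coord φ β y) hf.continuousOn hf0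
    (map_continuous (F.map h)) (hy.map _) ((hy.map (coord φ β)).map _)

theorem IsPositivePart.coord_eq {y a : A} (h : IsPositivePart y a) (α : Λ) :
    coord φ α a = (coord φ α y)⁺ := by
  obtain ⟨b, ha, hb, rfl, hab, -⟩ := h
  refine (CFC.posPart_negPart_unique (map_sub (coord φ α) a b) ?_ (coord_nonneg φ ha α)
    (coord_nonneg φ hb α)).1.symm
  rw [← map_mul, hab, map_zero]

theorem IsPositivePart.unique (φ : A ≃⋆ₐ[ℂ] F.limit) {y a a' : A}
    (h : IsPositivePart y a) (h' : IsPositivePart y a') : a = a' :=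
  ext_coord φ fun α => by rw [h.coord_eq φ, h'.coord_eq φ]

theorem IsPositivePart.commute (φ : A ≃⋆ₐ[ℂ] F.limit) {y a c : A}
    (h : IsPositivePart y a) (hc : Commute c y) : Commute c a := by
  refine ext_coord φ fun α => ?_
  have hc' : Commute (coord φ α y) (coord φ α c) := (hc.map (coord φ α)).symm
  rw [map_mul, map_mul, h.coord_eq φ, CFC.posPart_def]
  exact (Commute.cfcₙ_real hc' _).symm

theorem exists_isPositivePart (φ : A ≃⋆ₐ[ℂ] F.limit) {y : A} (hy : IsSelfAdjoint y) :
    ∃ a, IsPositivePart y a := by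
  -- Square roots are taken because positivity in `A` asks for an explicit factorisation `b* b`.
  obtain ⟨c, hc⟩ := exists_coord_cfcₙ φ (f := fun t : ℝ => √(t⁺)) (by fun_prop) (by simp) hy
  obtain ⟨d, hd⟩ := exists_coord_cfcₙ φ (f := fun t : ℝ => √(t⁻)) (by fun_prop) (by simp) hy
  have hc2 : ∀ α, coord φ α (star c * c) = (coord φ α y)⁺ := fun α => by
    rw [map_mul, map_star, hc, (cfcₙ_predicate _ _ : IsSelfAdjoint _).star_eq,
      ← cfcₙ_mul _ _ _ (by fun_prop) (by simp) (by fun_prop) (by simp), CFC.posPart_def]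
    simp only [Real.mul_self_sqrt (posPart_nonneg _)]
  have hd2 : ∀ α, coord φ α (star d * d) = (coord φ α y)⁻ := fun α => by
    rw [map_mul, map_star, hd, (cfcₙ_predicate _ _ : IsSelfAdjoint _).star_eq,
      ← cfcₙ_mul _ _ _ (by fun_prop) (by simp) (by fun_prop) (by simp), CFC.negPart_def]
    simp only [Real.mul_self_sqrt (negPart_nonneg _)]
  refine ⟨star c * c, star d * d, ⟨c, rfl⟩, ⟨d, rfl⟩, ?_, ?_, ?_⟩
  · refine ext_coord φ fun α => ?_
    rw [map_sub, hc2, hd2, CFC.posPart_sub_negPart _ (hy.map _)]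
  · refine ext_coord φ fun α => ?_
    rw [map_mul, hc2, hd2, CFC.posPart_mul_negPart, map_zero]
  · refine ext_coord φ fun α => ?_
    rw [map_mul, hc2, hd2, CFC.negPart_mul_posPart, map_zero]

theorem coord_stieltjesSum (α : Λ) (e : ℝ → A) (n : ℕ) (l m : ℕ → ℝ) :
    coord φ α (stieltjesSum e n l m) = stieltjesSum (fun t => coord φ α (e t)) n l m := by
  simp only [stieltjesSum, map_sum, map_smul, map_sub]

variable [TopologicalSpace A]

theorem continuous_coord (hφ : IsHomeomorph φ) (α : Λ) : Continuous (coord φ α) :=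
  (continuous_apply α).comp (continuous_subtype_val.comp hφ.continuous)

/-- A basic neighbourhood involves finitely many components; directedness gives one above them all,
and it controls them because *-homomorphisms are contractive. -/
theorem exists_coord_of_mem_nhds [IsDirectedOrder Λ] [Nonempty Λ] (hφ : IsHomeomorph φ) {a : A}
    {U : Set A} (hU : U ∈ 𝓝 a) :
    ∃ α, ∃ ε > 0, ∀ b, ‖coord φ α b - coord φ α a‖ < ε → b ∈ U := by
  have hind : IsInducing (fun b : A => (φ b : ∀ α, F.obj α)) :=
    IsInducing.subtypeVal.comp hφ.isEmbedding.isInducing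
  rw [hind.nhds_eq_comap, mem_comap] at hU
  obtain ⟨V, hV, hVU⟩ := hU
  rw [nhds_pi, mem_pi] at hV
  obtain ⟨I, hI, s, hs, hsV⟩ := hV
  have hball : ∀ᶠ ε in 𝓝[>] (0 : ℝ), ∀ i ∈ I, Metric.ball (coord φ i a) ε ⊆ s i := by
    rw [eventually_all_finite hI]
    intro i _
    obtain ⟨ε, hε, hε'⟩ := Metric.mem_nhds_iff.1 (hs i)
    filter_upwards [Ioo_mem_nhdsGT hε] with r hr
    exact (Metric.ball_subset_ball hr.2.le).trans hε'
  obtain ⟨ε, hε, hε0⟩ := (hball.and self_mem_nhdsWithin).exists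
  obtain ⟨β, hβ⟩ := hI.bddAbove
  refine ⟨β, ε, hε0, fun b hb => hVU (hsV fun i hi => hε i hi ?_)⟩
  rw [mem_ball_iff_norm]
  refine lt_of_le_of_lt ?_ hb
  change ‖coord φ i b - coord φ i a‖ ≤ _
  rw [← map_coord φ (hβ hi), ← map_coord φ (hβ hi), ← map_sub]
  exact NonUnitalStarAlgHom.norm_apply_le _ _

theorem HasStieltjesIntegralLine.coord (hφ : IsHomeomorph φ) {e : ℝ → A} {y : A}
    (h : HasStieltjesIntegralLine e y) (α : Λ) :
    HasStieltjesIntegralLine (fun t => coord φ α (e t)) (coord φ α y) := by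
  intro U hU
  obtain ⟨δ, hδ, R, H⟩ := h _ ((continuous_coord φ hφ α).continuousAt hU)
  refine ⟨δ, hδ, R, fun n l m hP h0 hn => ?_⟩
  rw [← coord_stieltjesSum]
  exact H n l m hP h0 hn

/-- The norm of a component, as a seminorm. -/
noncomputable def coordSeminorm (α : Λ) : Seminorm ℂ A :=
  (normSeminorm ℂ (F.obj α)).comp (coord φ α : A →ₗ[ℂ] F.obj α)

theorem isContinuousCStarSeminorm_coordSeminorm (hφ : IsHomeomorph φ) (α : Λ) :
    IsContinuousCStarSeminorm (coordSeminorm φ α) where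
  mul_le a b := by
    change ‖coord φ α (a * b)‖ ≤ ‖coord φ α a‖ * ‖coord φ α b‖
    rw [map_mul]; exact norm_mul_le _ _
  star_mul_self a := by
    change ‖coord φ α (star a * a)‖ = ‖coord φ α a‖ ^ 2
    rw [map_mul, map_star, CStarRing.norm_star_mul_self, sq]
  cont := (continuous_coord φ hφ α).norm

theorem HasSupNorm.norm_coord_le (hφ : IsHomeomorph φ) {x : A} {M : ℝ} (h : HasSupNorm x M)
    (α : Λ) : ‖coord φ α x‖ ≤ M :=
  h.1 ⟨_, isContinuousCStarSeminorm_coordSeminorm φ hφ α, rfl⟩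

end Coordinates

/-! ### Consequences of the Baer property. -/

section Baer

variable {A : Type u} [NonUnitalRing A] [StarRing A]

theorem mul_eq_zero_and_of_rightAnnihilator {a g : A} (hg : IsStarProjection g)
    (hR : rightAnnihilator {a} = principalRight g) : a * g = 0 ∧ ∀ r, a * r = 0 → g * r = r := by
  constructor
  · have : g ∈ rightAnnihilator {a} := hR ▸ ⟨g, hg.isIdempotentElem.eq⟩
    exact this a rfl
  · intro r hr
    have : r ∈ rightAnnihilator {a} := fun s hs => by rw [Set.mem_singleton_iff.1 hs, hr]
    rw [hR] at this
    obtain ⟨b, rfl⟩ := this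
    simp only [← mul_assoc, hg.isIdempotentElem.eq]

/-- The annihilator of `0` is all of `A`, so its projection is a left identity, and taking adjoints
makes it a right identity. -/
theorem IsBaerStar.exists_isUnitElement (hA : IsBaerStar A) : ∃ one : A, IsUnitElement one := by
  obtain ⟨g, hg, hR⟩ := hA {0} (Set.singleton_nonempty 0)
  have hleft : ∀ a, g * a = a := fun a =>
    (mul_eq_zero_and_of_rightAnnihilator hg hR).2 a (zero_mul a)
  refine ⟨g, fun a => ⟨hleft a, ?_⟩⟩
  have := congrArg star (hleft (star a))
  simpa [hg.isSelfAdjoint.star_eq] using this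

theorem IsUnitElement.isStarProjection {one : A} (h : IsUnitElement one) :
    IsStarProjection one := by
  refine ⟨(h one).1, ?_⟩
  have := congrArg star (h (star one)).2
  rw [star_mul, star_star, (h _).2] at this
  exact this

/-- If `R({a}) = gA`, then `g` commutes with every `c` such that `c` and `c*` commute with `a`. -/
theorem commute_of_rightAnnihilator {a g c : A} (hg : IsStarProjection g)
    (hR : rightAnnihilator {a} = principalRight g) (hc : Commute c a)
    (hc' : Commute (star c) a) : Commute c g := by
  obtain ⟨hag, mem⟩ := mul_eq_zero_and_of_rightAnnihilator hg hR
  -- Both `c` and `c*` leave `R({a})` invariant, so `g c g = c g` and, after an adjoint, `g c g = g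
  -- c`.
  have h1 : g * (c * g) = c * g :=
    mem _ (by rw [← mul_assoc, ← hc.eq, mul_assoc, hag, mul_zero])
  have h2 : g * (star c * g) = star c * g :=
    mem _ (by rw [← mul_assoc, ← hc'.eq, mul_assoc, hag, mul_zero])
  have h3 := congrArg star h2
  simp only [star_mul, star_star, hg.isSelfAdjoint.star_eq] at h3
  rw [Commute, SemiconjBy, ← h1, ← mul_assoc, h3]

theorem IsProjSup.unique {S : Set A} {p q : A} (hp : IsProjSup S p) (hq : IsProjSup S q) :
    p = q :=
  ProjLE.antisymm (hp.2.2 q hq.1 hq.2.1) (hq.2.2 p hp.1 hp.2.1) hp.1 hq.1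

end Baer

/-! ### Existence: the spectral family of `x`. -/

section SpectralProjection

variable {A : Type u} [NonUnitalRing A] [StarRing A] [Module ℂ A]

/-- `e` is the right support of the positive part `t e - x e` of `t 1 - x`. -/
structure IsSpectralProjection (one x : A) (t : ℝ) (e : A) : Prop where
  isProj : IsStarProjection e
  commute : ∀ c, Commute c x → Commute c e
  isPositivePart : IsPositivePart ((t : ℂ) • one - x) ((t : ℂ) • e - x * e)
  isRightSupport : IsRightSupport one ((t : ℂ) • e - x * e) e
  mul_eq_zero : ∀ r, ((t : ℂ) • e - x * e) * r = 0 → e * r = 0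
  isPositive_above : IsPositive (x * (one - e) - (t : ℂ) • (one - e))

variable {Λ : Type u} [PartialOrder Λ] {F : ProjectiveFamily Λ}

theorem exists_isSpectralProjection [IsScalarTower ℂ A A] [SMulCommClass ℂ A A]
    [StarModule ℂ A] (φ : A ≃⋆ₐ[ℂ] F.limit) (hA : IsBaerStar A) {one : A} (hone : IsUnitElement one)
    {x : A} (hx : IsSelfAdjoint x) (t : ℝ) :
    ∃ e, IsSpectralProjection one x t e := by
  have hy : IsSelfAdjoint ((t : ℂ) • one - x) := by
    refine IsSelfAdjoint.sub ?_ hx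
    rw [IsSelfAdjoint, star_smul, hone.isStarProjection.isSelfAdjoint.star_eq]
    simp
  obtain ⟨a, ha⟩ := exists_isPositivePart φ hy
  obtain ⟨b, ⟨c, hc⟩, ⟨d, hd⟩, hyab, hab, hba⟩ := id ha
  have hasa : IsSelfAdjoint a := hc ▸ IsSelfAdjoint.star_mul_self c
  have hbsa : IsSelfAdjoint b := hd ▸ IsSelfAdjoint.star_mul_self d
  obtain ⟨g, hg, hR⟩ := hA {a} (Set.singleton_nonempty a)
  obtain ⟨hag, mem⟩ := mul_eq_zero_and_of_rightAnnihilator hg hR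
  -- The negative part `b` lies in the annihilator of `a`, so `g` carries all of `b` and none of
  -- `a`; hence `(t 1 - x)(1 - g) = a`.
  have hgb : g * b = b := mem b hab
  have hbg : b * g = b :=
    mul_eq_of_mul_eq_left hbsa hg.isSelfAdjoint hgb
  have hyg : ((t : ℂ) • one - x) * g = -b := by rw [hyab, sub_mul, hag, hbg, zero_sub]
  have hye : (t : ℂ) • (one - g) - x * (one - g) = a := by
    have : (t : ℂ) • (one - g) - x * (one - g) =
        ((t : ℂ) • one - x) - ((t : ℂ) • one - x) * g := by
      rw [sub_mul, smul_mul_assoc, (hone g).1, mul_sub, (hone x).2, smul_sub]; abel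
    rw [this, hyg, hyab]; abel
  refine ⟨one - g, ?_, ?_, ?_, ?_, ?_, ?_⟩
  · exact ProjLE.isStarProjection_sub (hone g).2.symm hg hone.isStarProjection
  · intro c hcx
    have hcom : ∀ c, Commute c x → Commute c a := fun c hcx => by
      refine ha.commute φ (Commute.sub_right (Commute.smul_right ?_ _) hcx)
      exact (hone c).2.trans (hone c).1.symm
    have hcx' : Commute (star c) x := by
      have := hcx.star_star
      rwa [hx.star_eq] at this
    exact Commute.sub_right ((hone c).2.trans (hone c).1.symm)
      (commute_of_rightAnnihilator hg hR (hcom c hcx) (hcom _ hcx'))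
  · rwa [hye]
  · rw [hye]; exact ⟨g, hg, hR, rfl⟩
  · intro r hr
    rw [hye] at hr
    rw [sub_mul, (hone r).1, mem r hr, sub_self]
  · refine ⟨d, ?_⟩
    rw [← hd, sub_sub_cancel, ← neg_eq_iff_eq_neg.2 hyg, sub_mul, smul_mul_assoc, (hone g).1,
      neg_sub]

theorem IsSpectralProjection.isCut (φ : A ≃⋆ₐ[ℂ] F.limit) {one x e : A} {t : ℝ}
    (hone : IsUnitElement one) (h : IsSpectralProjection one x t e) (α : Λ) :
    IsCut (coord φ α one) (coord φ α x) t (coord φ α e) where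
  isProj := h.isProj.map _
  unit_mul := by rw [← map_mul, (hone e).1]
  comm := ((h.commute x (Commute.refl x)).symm).map (coord φ α)
  nonneg_below := by
    obtain ⟨_, ha, -⟩ := h.isPositivePart
    have := coord_nonneg φ ha α
    rwa [map_sub, coord_real_smul, map_mul] at this
  nonneg_above := by
    have := coord_nonneg φ h.isPositive_above α
    rwa [map_sub, coord_real_smul, map_mul, map_sub] at this

variable (φ : A ≃⋆ₐ[ℂ] F.limit) {one x : A} {e : ℝ → A}

theorem IsSpectralProjection.mono (φ : A ≃⋆ₐ[ℂ] F.limit) (hone : IsUnitElement one)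
    (he : ∀ t, IsSpectralProjection one x t (e t)) {s t : ℝ} (hst : s ≤ t) :
    ProjLE (e s) (e t) := by
  rcases hst.eq_or_lt with rfl | hlt
  · exact (he s).isProj.isIdempotentElem.eq.symm
  · refine projLE_of_coord φ fun α => ((he s).isCut φ hone α).projLE_of_lt
      ((he t).isCut φ hone α) hlt (Commute.map ?_ (coord φ α))
    exact (he t).commute _ ((he s).commute x (Commute.refl x)).symm

theorem IsSpectralProjection.coord_eq_one (hone : IsUnitElement one)
    (he : ∀ t, IsSpectralProjection one x t (e t)) {α : Λ} {t : ℝ} (ht : ‖coord φ α x‖ < t) :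
    coord φ α (e t) = coord φ α one :=
  ((he t).isCut φ hone α).eq_unit_of_norm_lt (hone.isStarProjection.map _) ht

theorem IsSpectralProjection.coord_eq_zero (hone : IsUnitElement one)
    (he : ∀ t, IsSpectralProjection one x t (e t)) {α : Λ} {t : ℝ} (ht : t < -‖coord φ α x‖) :
    coord φ α (e t) = 0 :=
  ((he t).isCut φ hone α).eq_zero_of_lt ht

/-- If `q` dominates every `e s` with `s < t`, then the positive part of `t 1 - x`, multiplied by `1
- q`, has norm at most `(t - s) ‖1 - q‖` in each component. Letting `s → t` makes the product
vanish, and the support property gives `e t (1 - q) = 0`. -/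
theorem IsSpectralProjection.isProjSup_Iio (φ : A ≃⋆ₐ[ℂ] F.limit) (hone : IsUnitElement one)
    (he : ∀ t, IsSpectralProjection one x t (e t)) (t : ℝ) :
    IsProjSup (e '' Set.Iio t) (e t) := by
  refine ⟨(he t).isProj, ?_, fun q hq hle => ?_⟩
  · rintro _ ⟨s, hs, rfl⟩
    exact mono φ hone he (le_of_lt hs)
  have key : e t * (one - q) = 0 := by
    refine (he t).mul_eq_zero _ (ext_coord φ fun α => ?_)
    rw [map_zero, map_mul, map_sub, coord_real_smul, map_mul]
    set r := coord φ α (one - q) with hr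
    have hs : ∀ s < t, ‖(t • coord φ α (e t) - coord φ α x * coord φ α (e t)) * r‖ ≤
        (t - s) * ‖r‖ := fun s hs => by
      refine ((he s).isCut φ hone α).norm_band_mul_le ((he t).isCut φ hone α) hs.le
        (projLE_coord φ (mono φ hone he hs.le) α) ?_
      rw [hr, ← map_mul, mul_sub, (hone _).2, (hle _ ⟨s, hs, rfl⟩).mul_eq, sub_self, map_zero]
    have hlim : Tendsto (fun s : ℝ => (t - s) * ‖r‖) (𝓝[<] t) (𝓝 0) := by
      have : Continuous fun s : ℝ => (t - s) * ‖r‖ := by fun_prop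
      simpa using (this.tendsto t).mono_left nhdsWithin_le_nhds
    exact norm_le_zero_iff.1
      (ge_of_tendsto hlim (eventually_mem_nhdsWithin.mono fun s h => hs s h))
  rw [mul_sub, (hone _).2] at key
  exact sub_eq_zero.1 key

theorem IsSpectralProjection.isSpectralFamily (φ : A ≃⋆ₐ[ℂ] F.limit) (hone : IsUnitElement one)
    (he : ∀ t, IsSpectralProjection one x t (e t)) : IsSpectralFamily one e where
  isProj t := (he t).isProj
  mono s t h := mono φ hone he h
  sup_eq_one := by
    refine ⟨hone.isStarProjection, fun p _ => (hone p).2.symm, fun q _ hle => ?_⟩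
    refine projLE_of_coord φ fun α => ?_
    have h := projLE_coord φ (hle _ ⟨‖coord φ α x‖ + 1, rfl⟩) α
    rwa [coord_eq_one φ hone he (by linarith)] at h
  inf_eq_zero := by
    refine ⟨.zero _, fun p _ => (zero_mul p).symm, fun q _ hle => ?_⟩
    refine projLE_of_coord φ fun α => ?_
    have h := projLE_coord φ (hle _ ⟨-‖coord φ α x‖ - 1, rfl⟩) α
    rwa [coord_eq_zero φ hone he (by linarith), ← map_zero (coord φ α)] at h
  left_cont := isProjSup_Iio φ hone he

/-- Order estimates give vanishing only strictly below `-M`; left continuity extends it to `-M`. At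
`M` a jump remains possible, which is why the bounded integral runs up to `M + ε`. -/
theorem IsSpectralProjection.eq_zero_of_norm_le (φ : A ≃⋆ₐ[ℂ] F.limit) (hone : IsUnitElement one)
    (he : ∀ t, IsSpectralProjection one x t (e t)) {M : ℝ} (hM : ∀ α, ‖coord φ α x‖ ≤ M) :
    e (-M) = 0 := by
  refine (isProjSup_Iio φ hone he (-M)).unique ⟨.zero _, ?_, fun q _ _ => (zero_mul q).symm⟩
  rintro _ ⟨s, hs, rfl⟩
  have : e s = 0 := ext_coord φ fun α => by
    rw [coord_eq_zero φ hone he (lt_of_lt_of_le hs (neg_le_neg (hM α))), map_zero]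
  rw [this]
  exact (zero_mul _).symm

theorem IsSpectralProjection.norm_coord_stieltjesSum_sub_le (hone : IsUnitElement one)
    (he : ∀ t, IsSpectralProjection one x t (e t)) {α : Λ} {δ : ℝ} (hδ : 0 ≤ δ) {n : ℕ}
    {l m : ℕ → ℝ} (hP : IsTaggedPartition δ n l m) (h0 : coord φ α (e (l 0)) = 0)
    (hn : coord φ α (e (l n)) = coord φ α one) :
    ‖coord φ α (stieltjesSum e n l m) - coord φ α x‖ ≤ 3 * δ := by
  rw [coord_stieltjesSum]
  exact norm_stieltjesSum_sub_le (hone.isStarProjection.map _)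
    (by rw [← map_mul, (hone x).2]) (fun t => (he t).isCut φ hone α)
    (fun s t h => projLE_coord φ (mono φ hone he h) α) hδ hP h0 hn

/-- Since `e` commutes with `B`, adjoining it to `B` gives a commutative *-subalgebra, which
maximality puts back inside `B`. -/
theorem IsSpectralProjection.mem_of_isMaximalCommutative [IsScalarTower ℂ A A]
    [SMulCommClass ℂ A A] [StarModule ℂ A] {e : A} {t : ℝ}
    (he : IsSpectralProjection one x t e) {B : NonUnitalStarSubalgebra ℂ A}
    (hB : IsMaximalCommutative B) (hxB : x ∈ B) : e ∈ B := by
  have hcomm : ∀ b ∈ B, b * e = e * b := fun b hb => (he.commute b (hB.prop b hb x hxB)).eq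
  have hes := he.isProj.isSelfAdjoint.star_eq
  have hpair : ∀ a ∈ insert e (B : Set A), ∀ b ∈ insert e (B : Set A), a * b = b * a := by
    rintro a (rfl | ha) b (rfl | hb)
    · rfl
    · exact (hcomm b hb).symm
    · exact hcomm a ha
    · exact hB.prop a ha b hb
  have hstar : ∀ b ∈ insert e (B : Set A), star b ∈ insert e (B : Set A) := by
    rintro b (rfl | hb)
    · exact .inl hes
    · exact .inr (star_mem hb)
  have hC := NonUnitalStarAlgebra.isMulCommutative_adjoin ℂ hpair
    fun a ha b hb => hpair a ha _ (hstar b hb)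
  have hle : NonUnitalStarAlgebra.adjoin ℂ (insert e (B : Set A)) ≤ B :=
    hB.le_of_ge
      (fun a ha b hb => congrArg Subtype.val (hC.is_comm.comm ⟨a, ha⟩ ⟨b, hb⟩))
      (fun b hb => NonUnitalStarAlgebra.subset_adjoin ℂ _ (.inr hb))
  exact hle (NonUnitalStarAlgebra.subset_adjoin ℂ _ (.inl rfl))

variable [TopologicalSpace A]

theorem IsSpectralProjection.hasStieltjesIntegralLine [IsDirectedOrder Λ] [Nonempty Λ]
    (hφ : IsHomeomorph φ) (hone : IsUnitElement one)
    (he : ∀ t, IsSpectralProjection one x t (e t)) : HasStieltjesIntegralLine e x := by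
  intro U hU
  obtain ⟨α, ε, hε, H⟩ := exists_coord_of_mem_nhds φ hφ hU
  -- The error is at most `3 (ε / 4) < ε`. Adding `1` puts the end points strictly beyond `±‖x‖` in
  -- the component `α`.
  refine ⟨ε / 4, by positivity, ‖coord φ α x‖ + 1, fun n l m hP h0 hn => H _ ?_⟩
  refine (norm_coord_stieltjesSum_sub_le φ hone he (by positivity) hP
    (coord_eq_zero φ hone he (by linarith)) (coord_eq_one φ hone he (by linarith))).trans_lt ?_
  linarith

theorem IsSpectralProjection.hasStieltjesIntegral [IsDirectedOrder Λ] [Nonempty Λ]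
    (hφ : IsHomeomorph φ) (hone : IsUnitElement one)
    (he : ∀ t, IsSpectralProjection one x t (e t)) {M : ℝ} (hM : HasSupNorm x M) {η : ℝ}
    (hη : 0 < η) : HasStieltjesIntegral e (-M) (M + η) x := by
  intro U hU
  obtain ⟨α, ε, hε, H⟩ := exists_coord_of_mem_nhds φ hφ hU
  have hM' := hM.norm_coord_le φ hφ
  refine ⟨ε / 4, by positivity, fun n l m hP h0 hn => H _ ?_⟩
  refine (norm_coord_stieltjesSum_sub_le φ hone he (by positivity) hP
    (by rw [h0, eq_zero_of_norm_le φ hone he hM', map_zero])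
    (coord_eq_one φ hone he (by linarith [hM' α]))).trans_lt ?_
  linarith

/-! ### Uniqueness of the spectral family. -/

/-- The components of a spectral family with convergent integral vanish near `-∞` and equal the
unit near `∞`. -/
theorem IsSpectralFamily.exists_coord_eq_zero_one (hφ : IsHomeomorph φ) (hone : IsUnitElement one)
    {f : ℝ → A} (hf : IsSpectralFamily one f) (hx : HasStieltjesIntegralLine f x) (α : Λ) :
    ∃ R : ℝ, (∀ s ≤ -R, coord φ α (f s) = 0) ∧ ∀ s, R ≤ s → coord φ α (f s) = coord φ α one := by
  have hconst := fun α => (hx.coord φ hφ α).eventually_const (fun t => (hf.isProj t).map _)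
    (fun s t h => projLE_coord φ (hf.mono s t h) α)
  choose R hlow hhigh using hconst
  -- The thresholds vary with the component, but the constant values agree under the connecting
  -- maps: evaluate both at a point beyond both thresholds. The glued `p` lies under every `f t`,
  -- hence is `0`; dually `q` is `one`.
  obtain ⟨p, hp⟩ := exists_coord_eq φ (z := fun α => coord φ α (f (-R α))) fun α β h => by
    rw [← hlow β (min (-R α) (-R β)) (min_le_right _ _), map_coord,
      hlow α _ (min_le_left _ _)]
  obtain ⟨q, hq⟩ := exists_coord_eq φ (z := fun α => coord φ α (f (R α))) fun α β h => by
    rw [← hhigh β (max (R α) (R β)) (le_max_right _ _), map_coord,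
      hhigh α _ (le_max_left _ _)]
  have hp0 : p = 0 := by
    have h := hf.inf_eq_zero.2.2 p
      (isStarProjection_of_coord φ fun α => by rw [hp]; exact (hf.isProj _).map _) (by
        rintro _ ⟨t, rfl⟩
        refine projLE_of_coord φ fun α => ?_
        rw [hp, ← hlow α (min (-R α) t) (min_le_left _ _)]
        exact projLE_coord φ (hf.mono _ _ (min_le_right _ _)) α)
    rw [h, mul_zero]
  have hq1 : q = one := by
    have h := hf.sup_eq_one.2.2 q
      (isStarProjection_of_coord φ fun α => by rw [hq]; exact (hf.isProj _).map _) (by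
        rintro _ ⟨t, rfl⟩
        refine projLE_of_coord φ fun α => ?_
        rw [hq, ← hhigh α (max (R α) t) (le_max_left _ _)]
        exact projLE_coord φ (hf.mono _ _ (le_max_right _ _)) α)
    rw [h, (hone q).1]
  refine ⟨R α, fun s hs => ?_, fun s hs => ?_⟩
  · rw [hlow α s hs, ← hp α, hp0, map_zero]
  · rw [hhigh α s hs, ← hq α, hq1]

theorem IsSpectralFamily.isCut (hφ : IsHomeomorph φ) (hone : IsUnitElement one)
    {f : ℝ → A} (hf : IsSpectralFamily one f) (hx : HasStieltjesIntegralLine f x) (α : Λ)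
    (t : ℝ) : IsCut (coord φ α one) (coord φ α x) t (coord φ α (f t)) := by
  obtain ⟨R, hlow, hhigh⟩ := hf.exists_coord_eq_zero_one φ hφ hone hx α
  exact (hx.coord φ hφ α).isCut (fun t => (hf.isProj t).map _)
    (fun s t h => projLE_coord φ (hf.mono s t h) α) (hone.isStarProjection.map _)
    (fun t => by rw [← map_mul, (hone _).1]) hlow hhigh t

theorem IsSpectralFamily.eq_of_isSpectralProjection (hφ : IsHomeomorph φ)
    (hone : IsUnitElement one) (he : ∀ t, IsSpectralProjection one x t (e t)) {f : ℝ → A}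
    (hf : IsSpectralFamily one f) (hx : HasStieltjesIntegralLine f x) : f = e := by
  have hfcut := hf.isCut φ hφ hone hx
  have hfx : ∀ s, Commute (f s) x := fun s => ext_coord φ fun α => by
    rw [map_mul, map_mul]; exact (hfcut α s).comm
  -- Comparing cuts requires them to commute: each `f s` commutes with `x`, hence with every `e t`.
  have hcomm : ∀ s t, Commute (f s) (e t) := fun s t => (he t).commute _ (hfx s)
  have hes := IsSpectralProjection.isSpectralFamily φ hone he
  funext t
  refine ProjLE.antisymm ?_ ?_ (hf.isProj t) (hes.isProj t)
  · refine (hf.left_cont t).2.2 _ (hes.isProj t) ?_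
    rintro _ ⟨s, hs, rfl⟩
    exact projLE_of_coord φ fun α => (hfcut α s).projLE_of_lt ((he t).isCut φ hone α) hs
      ((hcomm s t).map (coord φ α))
  · refine (hes.left_cont t).2.2 _ (hf.isProj t) ?_
    rintro _ ⟨s, hs, rfl⟩
    exact projLE_of_coord φ fun α => ((he s).isCut φ hone α).projLE_of_lt (hfcut α t) hs
      ((hcomm t s).symm.map (coord φ α))

end SpectralProjection

end LocallyAW

theorem theorem4 {A : Type u} [NonUnitalRing A] [StarRing A] [Module ℂ A]
    [IsScalarTower ℂ A A] [SMulCommClass ℂ A A] [StarModule ℂ A] [TopologicalSpace A]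
    (hA : LocallyAW.IsLocallyAWStarAlgebra A) :
    ∃ one : A, LocallyAW.IsUnitElement one ∧
      ∀ x : A, IsSelfAdjoint x →
        ∃ e : ℝ → A,
          LocallyAW.IsSpectralFamily one e ∧
          -- `e t` is the right support of the positive part of `t 1 - x`
          (∀ t : ℝ, (∃! a, LocallyAW.IsPositivePart ((t : ℂ) • one - x) a) ∧
            ∀ a, LocallyAW.IsPositivePart ((t : ℂ) • one - x) a →
              LocallyAW.IsRightSupport one a (e t)) ∧
          (∀ B : NonUnitalStarSubalgebra ℂ A, LocallyAW.IsMaximalCommutative B → x ∈ B →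
            ∀ t, e t ∈ B) ∧
          LocallyAW.HasStieltjesIntegralLine e x ∧
          (∀ M : ℝ, LocallyAW.HasSupNorm x M →
            ∀ ε > 0, LocallyAW.HasStieltjesIntegral e (-M) (M + ε) x) ∧
          ∀ f : ℝ → A, LocallyAW.IsSpectralFamily one f →
            LocallyAW.HasStieltjesIntegralLine f x → f = e := by
  obtain ⟨Λ, _, _, _, F, φ, hφ⟩ := hA.locallyCStar
  obtain ⟨one, hone⟩ := hA.baer.exists_isUnitElement
  refine ⟨one, hone, fun x hx => ?_⟩
  choose e he using LocallyAW.exists_isSpectralProjection φ hA.baer hone hx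
  refine ⟨e, LocallyAW.IsSpectralProjection.isSpectralFamily φ hone he, fun t => ⟨?_, ?_⟩,
    fun B hB hxB t => (he t).mem_of_isMaximalCommutative hB hxB,
    LocallyAW.IsSpectralProjection.hasStieltjesIntegralLine φ hφ hone he,
    fun M hM ε hε => LocallyAW.IsSpectralProjection.hasStieltjesIntegral φ hφ hone he hM hε,
    fun f hf hfx => hf.eq_of_isSpectralProjection φ hφ hone he hfx⟩
  · exact ⟨_, (he t).isPositivePart, fun a ha => ha.unique φ (he t).isPositivePart⟩
  · intro a ha
    rw [ha.unique φ (he t).isPositivePart]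
    exact (he t).isRightSupport
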